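/- Let $R$ be an integral domain with field of fractions $K$. A fractional ideal of $R$ is an $R$-submodule $\mathfrak a\subseteq K$ with $d\mathfrak a\subseteq R$ for some nonzero $d\in R$. A nonzero fractional ideal is called divisorial if it is the intersection of the principal fractional ideals $Rx$ ($x\in K$, $x\neq 0$) that contain it. A divisor of $R$ is an equivalence class $\operatorname{div}\mathfrak a$ of nonzero fractional ideals $\mathfrak a$, two of them being equivalent if they are contained in the same principal fractional ideals; divisors are ordered by: $\operatorname{div}\mathfrak a\le\operatorname{div}\mathfrak b$ if every principal fractional ideal containing $\mathfrak a$ contains $\mathfrak b$. A divisor is integral if it is $\ge\operatorname{div}R$, and principal if it equals $\operatorname{div}(Rx)$ for some nonzero $x\in K$. The domain $R$ is a Krull domain if there is a (possibly empty) family $(v_i)_{i\in I}$ of surjective discrete valuations $v_i:K\to\mathbb Z\cup\{\infty\}$ such that $R=\{x\in K: v_i(x)\ge 0\text{ for all }i\in I\}$ and, for each nonzero $x\in K$, $v_i(x)\ne 0$ for only finitely many $i\in I$. A Dedekind domain is a Noetherian, integrally closed domain of Krull dimension at most one (fields are included). Theorem 3.2. (1) $R$ is a Dedekind domain if and only if $R$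 is a Krull domain and every nonzero ideal of $R$ is divisorial. (2) $R$ is a unique factorization domain if and only if $R$ is a Krull domain and every integral divisor of $R$ is principal. -/

import Mathlib

open scoped nonZeroDivisors

/-- A domain `R` with field of fractions `K` is a *Krull domain* if there is a family of normed
discrete valuations of `K` (valuations with value group exactly `ℤ`, written multiplicatively as
`ℤᵐ⁰`, hence surjective) whose valuation rings intersect in `R`, and such that every nonzero
element of `K` has nontrivial value for only finitely many members of the family. The empty family
is allowed, so that fields are Krull domains. -/
def IsKrullDomain (R K : Type*) [CommRing R] [IsDomain R] [Field K] [Algebra R K]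
    [IsFractionRing R K] : Prop :=
  ∃ S : Set (Valuation K (WithZero (Multiplicative ℤ))),
    (∀ v ∈ S, Function.Surjective v) ∧
    (∀ x : K, (∃ r : R, algebraMap R K r = x) ↔ ∀ v ∈ S, v x ≤ 1) ∧
    (∀ x : K, x ≠ 0 → {v ∈ S | v x ≠ 1}.Finite)

section Divisors

variable (R K : Type*) [CommRing R] [IsDomain R] [Field K] [Algebra R K] [IsFractionRing R K]

/-- A nonzero fractional ideal `a` is *divisorial* if it is the intersection of the nonzero
principal fractional ideals `R x` that contain it. -/
def IsDivisorial (a : FractionalIdeal R⁰ K) : Prop :=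
  a ≠ 0 ∧ ∀ y : K, y ∈ a ↔
    ∀ x : K, x ≠ 0 → a ≤ FractionalIdeal.spanSingleton R⁰ x →
      y ∈ FractionalIdeal.spanSingleton R⁰ x

/-- The type of nonzero fractional ideals of `R` in `K`. -/
abbrev NonzeroFractionalIdeal : Type _ := {a : FractionalIdeal R⁰ K // a ≠ 0}

variable {R K}

/-- The preorder `a ≺ b` on nonzero fractional ideals: every nonzero principal fractional ideal
that contains `a` also contains `b`. -/
def DivPrec (a b : NonzeroFractionalIdeal R K) : Prop :=
  ∀ x : K, x ≠ 0 → a.1 ≤ FractionalIdeal.spanSingleton R⁰ x →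
    b.1 ≤ FractionalIdeal.spanSingleton R⁰ x

variable (R K)

/-- Two nonzero fractional ideals are equivalent if they are contained in the same nonzero
principal fractional ideals. -/
def divisorSetoid : Setoid (NonzeroFractionalIdeal R K) where
  r a b := DivPrec a b ∧ DivPrec b a
  iseqv :=
    { refl := fun _ => ⟨fun _ _ h => h, fun _ _ h => h⟩
      symm := fun h => ⟨h.2, h.1⟩
      trans := fun h k =>
        ⟨fun x hx hh => k.1 x hx (h.1 x hx hh), fun x hx hh => h.2 x hx (k.2 x hx hh)⟩ }

/-- A *divisor* of `R` is a class of nonzero fractional ideals, where two of them are identified if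
they are contained in the same principal fractional ideals. -/
def Divisor : Type _ := Quotient (divisorSetoid R K)

variable {R K}

namespace Divisor

/-- The divisor `div a` of a nonzero fractional ideal `a`. -/
def div (a : NonzeroFractionalIdeal R K) : Divisor R K := Quotient.mk (divisorSetoid R K) a

/-- The order of divisors: `div a ≤ div b` if and only if `a ≺ b`. -/
instance : LE (Divisor R K) where
  le D E := Quotient.liftOn₂ D E DivPrec fun _ _ _ _ h k => propext
    ⟨fun hab x hx hh => k.1 x hx (hab x hx (h.2 x hx hh)),
      fun hab x hx hh => k.2 x hx (hab x hx (h.1 x hx hh))⟩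

/-- The divisor `div x = div (R x)` of a nonzero element `x` of `K`. -/
noncomputable def ofElement (x : K) (hx : x ≠ 0) : Divisor R K :=
  div ⟨FractionalIdeal.spanSingleton R⁰ x, FractionalIdeal.spanSingleton_ne_zero_iff.mpr hx⟩

/-- The zero divisor: the divisor of the fractional ideal `R`. -/
noncomputable instance : Zero (Divisor R K) where
  zero := div ⟨1, one_ne_zero⟩

/-- A divisor is *integral* if it is at least the divisor of `R`. -/
def IsIntegral (D : Divisor R K) : Prop := 0 ≤ D

/-- A divisor is *principal* if it is the divisor of a nonzero element of `K`. -/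
def IsPrincipal (D : Divisor R K) : Prop := ∃ (x : K) (hx : x ≠ 0), D = ofElement x hx

end Divisor

end Divisors

/-! ### Inverses of fractional ideals and the Dedekind case. -/

section Basic

variable {R K : Type*} [CommRing R] [IsDomain R] [Field K] [Algebra R K] [IsFractionRing R K]

open FractionalIdeal

/-! Dedekind case: invertible ideals are divisorial. Conversely, a Krull domain is completely
integrally closed, and elements of `(I I⁻¹)⁻¹` stabilize `I⁻¹`, so they lie in `R`. Hence every `R
x` containing `I I⁻¹` has `x⁻¹ ∈ R` and contains 1; as `I I⁻¹` is divisorial, it is `R`.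

Factorial case: the `p`-adic valuations give the Krull property, and an ideal has the divisor of its
gcd. Conversely, the sum of the valuations strictly increases under proper divisibility, which gives
the chain condition on principal ideals. A generator of `div (a, b)` is a gcd of `a` and `b`, and
the two properties together yield unique factorization. -/

/-- For `x ≠ 0`, the inclusion `a ≤ R x` amounts to `x⁻¹ ∈ a⁻¹`. -/
theorem FractionalIdeal.le_spanSingleton_iff_inv_mem {a : FractionalIdeal R⁰ K} (ha : a ≠ 0)
    {x : K} (hx : x ≠ 0) : a ≤ spanSingleton R⁰ x ↔ x⁻¹ ∈ a⁻¹ := by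
  rw [mem_inv_iff ha]
  constructor
  · intro h y hy
    obtain ⟨r, rfl⟩ := (mem_spanSingleton R⁰).1 (h hy)
    rw [Algebra.smul_def, mul_left_comm, inv_mul_cancel₀ hx, mul_one]
    exact (mem_one_iff R⁰).2 ⟨r, rfl⟩
  · intro h y hy
    obtain ⟨r, hr⟩ := (mem_one_iff R⁰).1 (h y hy)
    refine (mem_spanSingleton R⁰).2 ⟨r, ?_⟩
    rw [Algebra.smul_def, hr, mul_comm, mul_inv_cancel_left₀ hx]

/-- Invertible fractional ideals are divisorial. -/
theorem IsDivisorial.of_mul_inv_cancel {a : FractionalIdeal R⁰ K} (ha : a ≠ 0)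
    (h : a * a⁻¹ = 1) : IsDivisorial R K a := by
  refine ⟨ha, fun y => ⟨fun hy x _ hax => hax hy, fun H => ?_⟩⟩
  -- Each nonzero `z ∈ a⁻¹` gives a principal ideal `R z⁻¹` containing `a`, hence `y`. Multiplying
  -- `y a⁻¹ ≤ R` by `a` then gives `y ∈ a`.
  have key : spanSingleton R⁰ y * a⁻¹ ≤ 1 := by
    rw [spanSingleton_mul_le_iff]
    intro z hz
    by_cases hz0 : z = 0
    · simp [hz0]
    have hy := H z⁻¹ (inv_ne_zero hz0)
      ((le_spanSingleton_iff_inv_mem ha (inv_ne_zero hz0)).2 (by rwa [inv_inv]))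
    obtain ⟨r, rfl⟩ := (mem_spanSingleton R⁰).1 hy
    rw [Algebra.smul_def, mul_assoc, inv_mul_cancel₀ hz0, mul_one]
    exact (mem_one_iff R⁰).2 ⟨r, rfl⟩
  have := mul_le_mul_right key a
  rw [mul_left_comm, h, mul_one, mul_one, spanSingleton_le_iff_mem] at this
  exact this

/-- A Dedekind domain is a Krull domain. -/
theorem IsDedekindDomain.isKrullDomain (R K : Type*) [CommRing R] [IsDedekindDomain R]
    [Field K] [Algebra R K] [IsFractionRing R K] : IsKrullDomain R K := by
  refine ⟨Set.range fun v : IsDedekindDomain.HeightOneSpectrum R => v.valuation K, ?_, ?_, ?_⟩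
  · rintro _ ⟨v, rfl⟩
    exact v.valuation_surjective K
  · intro x
    constructor
    · rintro ⟨r, rfl⟩ _ ⟨v, rfl⟩
      exact v.valuation_le_one r
    · intro h
      exact HeightOneSpectrum.mem_integers_of_valuation_le_one K x fun v => h _ ⟨v, rfl⟩
  · intro x hx
    refine (((HeightOneSpectrum.Support.finite R x).union
      (HeightOneSpectrum.Support.finite R x⁻¹)).image fun v => v.valuation K).subset ?_
    rintro _ ⟨⟨v, rfl⟩, hv⟩
    refine ⟨v, ?_, rfl⟩
    rcases lt_or_gt_of_ne hv with h | h
    · right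
      change 1 < v.valuation K x⁻¹
      rw [map_inv₀]
      exact (one_lt_inv₀ (zero_lt_iff.2 ((Valuation.ne_zero_iff _).2 hx))).2 h
    · exact Or.inl h

/-- A Krull domain is completely integrally closed: an element with almost integral powers is
integral. -/
theorem IsKrullDomain.mem_one_of_forall_pow (h : IsKrullDomain R K) {x d : K} (hd : d ≠ 0)
    (hx : ∀ n : ℕ, d * x ^ n ∈ (1 : FractionalIdeal R⁰ K)) :
    x ∈ (1 : FractionalIdeal R⁰ K) := by
  obtain ⟨S, -, hS, -⟩ := h
  refine (mem_one_iff R⁰).2 ((hS x).2 fun v hv => ?_)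
  by_contra! hlt
  have hvd : v d ≠ 0 := (Valuation.ne_zero_iff _).2 hd
  -- Powers of `v x > 1` reach `(v d)⁻¹`; one more factor makes the inequality strict.
  obtain ⟨n, hn⟩ := MulArchimedean.arch (v d)⁻¹ hlt
  have h1 := (hS _).1 ((mem_one_iff R⁰).1 (hx (n + 1))) v hv
  rw [map_mul, map_pow] at h1
  have h2 : v x ^ (n + 1) ≤ (v d)⁻¹ := by
    rwa [le_inv_mul_iff₀ (zero_lt_iff.2 hvd) |>.symm, mul_one] at h1
  have h3 : v x ^ n < v x ^ (n + 1) := pow_lt_pow_right₀ hlt (Nat.lt_succ_self n)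
  exact absurd (hn.trans_lt h3) (not_lt.2 h2)

/-- The inverse of a nonzero fractional ideal is nonzero. -/
theorem FractionalIdeal.inv_ne_zero_of_ne_zero {I : FractionalIdeal R⁰ K} (hI : I ≠ 0) :
    I⁻¹ ≠ 0 := by
  obtain ⟨a, ha, h⟩ := I.isFractional
  intro h0
  have hmem : algebraMap R K a ∈ I⁻¹ := by
    rw [mem_inv_iff hI]
    intro y hy
    obtain ⟨r, hr⟩ := h y hy
    exact (mem_one_iff R⁰).2 ⟨r, by rw [hr, Algebra.smul_def]⟩
  rw [h0, FractionalIdeal.mem_zero_iff] at hmem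
  exact nonZeroDivisors.ne_zero ha (by simpa using hmem)

/-- A nonzero fractional ideal contains a nonzero element. -/
theorem FractionalIdeal.exists_mem_ne_zero {I : FractionalIdeal R⁰ K} (hI : I ≠ 0) :
    ∃ x ∈ I, x ≠ 0 := by
  by_contra! H
  exact hI (eq_zero_iff.2 H)

theorem FractionalIdeal.mul_inv_ne_zero {I : FractionalIdeal R⁰ K} (hI : I ≠ 0) :
    I * I⁻¹ ≠ 0 := by
  obtain ⟨d, hd, hd0⟩ := exists_mem_ne_zero hI
  obtain ⟨e, he, he0⟩ := exists_mem_ne_zero (inv_ne_zero_of_ne_zero hI)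
  exact fun h0 => mul_ne_zero hd0 he0 (eq_zero_iff.1 h0 _ (mul_mem_mul hd he))

/-- In a Krull domain, `(I I⁻¹)⁻¹ ≤ R`. -/
theorem IsKrullDomain.inv_mul_inv_le_one (h : IsKrullDomain R K) {I : FractionalIdeal R⁰ K}
    (hI : I ≠ 0) : (I * I⁻¹)⁻¹ ≤ 1 := by
  intro x hx
  -- So `x ^ n * d ∈ I⁻¹` for all `n`, and `d * e` is a common denominator of the powers of `x`.
  have hmul : ∀ z ∈ I⁻¹, x * z ∈ I⁻¹ := by
    intro z hz
    rw [mem_inv_iff hI]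
    intro y hy
    have := (mem_inv_iff (mul_inv_ne_zero hI)).1 hx (y * z) (mul_mem_mul hy hz)
    rwa [mul_comm y, ← mul_assoc] at this
  obtain ⟨d, hd, hd0⟩ := exists_mem_ne_zero (inv_ne_zero_of_ne_zero hI)
  obtain ⟨e, he, he0⟩ := exists_mem_ne_zero hI
  refine h.mem_one_of_forall_pow (mul_ne_zero hd0 he0) fun n => ?_
  have hn : x ^ n * d ∈ I⁻¹ := by
    induction n with
    | zero => simpa using hd
    | succ n ih =>
      rw [pow_succ', mul_assoc]
      exact hmul _ ih
  have := (mem_inv_iff hI).1 hn e he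
  rwa [mul_assoc, mul_comm] at this

/-- A Krull domain all of whose nonzero ideals are divisorial is a Dedekind domain. -/
theorem IsKrullDomain.isDedekindDomain (h : IsKrullDomain R K)
    (hdiv : ∀ I : Ideal R, I ≠ ⊥ → IsDivisorial R K (I : FractionalIdeal R⁰ K)) :
    IsDedekindDomain R := by
  rw [isDedekindDomain_iff_mul_inv_cancel (K := K)]
  intro I hI
  have hle : I * I⁻¹ ≤ 1 := mul_one_div_le_one
  obtain ⟨J, hJ⟩ := le_one_iff_exists_coeIdeal.1 hle
  have hinv := h.inv_mul_inv_le_one hI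
  refine le_antisymm hle ?_
  rw [← spanSingleton_one, spanSingleton_le_iff_mem]
  have hJ0 : J ≠ ⊥ := by
    rintro rfl
    exact mul_inv_ne_zero hI (by rw [← hJ, coeIdeal_bot])
  have hJK := hdiv J hJ0
  rw [hJ] at hJK
  refine (hJK.2 1).2 fun x hx hle' => ?_
  obtain ⟨r, hr⟩ := (mem_one_iff R⁰).1 (hinv ((le_spanSingleton_iff_inv_mem hJK.1 hx).1 hle'))
  refine (mem_spanSingleton R⁰).2 ⟨r, ?_⟩
  rw [Algebra.smul_def, hr, inv_mul_cancel₀ hx]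

end Basic

/-! ### Valuations attached to prime elements. -/

section PrimeValuation

variable {R : Type*} (K : Type*) [CommRing R] [IsDomain R] [Field K] [Algebra R K]
  [IsFractionRing R K] [WfDvdMonoid R]

open Classical WithZero in
/-- The `p`-adic valuation on a factorial domain, for a prime element `p`. -/
noncomputable def Prime.integralValuation {p : R} (hp : Prime p) :
    Valuation R (WithZero (Multiplicative ℤ)) where
  -- Zero is set apart because `multiplicity p 0` has the default value 1.
  toFun x := if x = 0 then 0 else exp (-(multiplicity p x : ℤ))
  map_zero' := if_pos rfl
  map_one' := by simp [multiplicity_of_one_right hp.not_isUnit]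
  map_mul' x y := by
    by_cases hx : x = 0
    · simp [hx]
    by_cases hy : y = 0
    · simp [hy]
    rw [if_neg (mul_ne_zero hx hy), if_neg hx, if_neg hy,
      multiplicity_mul hp (FiniteMultiplicity.of_prime_left hp (mul_ne_zero hx hy)), ← exp_add]
    congr 1
    push_cast
    ring
  map_add_le_max' x y := by
    by_cases hx : x = 0
    · simp [hx]
    by_cases hy : y = 0
    · simp [hy]
    by_cases hxy : x + y = 0
    · simp [hxy]
    rw [if_neg hx, if_neg hy, if_neg hxy, le_max_iff, exp_le_exp, exp_le_exp, neg_le_neg_iff,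
      neg_le_neg_iff, Nat.cast_le, Nat.cast_le, ← min_le_iff]
    have h := min_le_emultiplicity_add (p := p) (a := x) (b := y)
    rw [(FiniteMultiplicity.of_prime_left hp hx).emultiplicity_eq_multiplicity,
      (FiniteMultiplicity.of_prime_left hp hy).emultiplicity_eq_multiplicity,
      (FiniteMultiplicity.of_prime_left hp hxy).emultiplicity_eq_multiplicity, min_le_iff] at h
    simpa only [min_le_iff, Nat.cast_le] using h

theorem Prime.integralValuation_apply {p : R} (hp : Prime p) {x : R} (hx : x ≠ 0) :
    hp.integralValuation x = WithZero.exp (-(multiplicity p x : ℤ)) :=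
  if_neg hx

theorem Prime.nonZeroDivisors_le_primeCompl {p : R} (hp : Prime p) :
    R⁰ ≤ hp.integralValuation.supp.primeCompl := by
  intro x hx h
  rw [SetLike.mem_coe, Valuation.mem_supp_iff,
    hp.integralValuation_apply (nonZeroDivisors.ne_zero hx)] at h
  exact WithZero.exp_ne_zero h

/-- The `p`-adic valuation on the field of fractions of a factorial domain. -/
noncomputable def Prime.valuation {p : R} (hp : Prime p) :
    Valuation K (WithZero (Multiplicative ℤ)) :=
  hp.integralValuation.extendToLocalization hp.nonZeroDivisors_le_primeCompl K

theorem Prime.valuation_algebraMap {p : R} (hp : Prime p) {x : R} (hx : x ≠ 0) :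
    hp.valuation K (algebraMap R K x) = WithZero.exp (-(multiplicity p x : ℤ)) := by
  rw [Prime.valuation, Valuation.extendToLocalization_apply_map_apply,
    hp.integralValuation_apply hx]

theorem Prime.valuation_algebraMap_le_one {p : R} (hp : Prime p) (x : R) :
    hp.valuation K (algebraMap R K x) ≤ 1 := by
  by_cases hx : x = 0
  · simp [hx]
  · rw [hp.valuation_algebraMap K hx, ← WithZero.exp_zero, WithZero.exp_le_exp]
    omega

theorem Prime.valuation_algebraMap_eq_one_iff {p : R} (hp : Prime p) {x : R} (hx : x ≠ 0) :
    hp.valuation K (algebraMap R K x) = 1 ↔ ¬ p ∣ x := by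
  rw [hp.valuation_algebraMap K hx, WithZero.exp_eq_one, neg_eq_zero, Nat.cast_eq_zero,
    multiplicity_eq_zero]

theorem Prime.valuation_surjective {p : R} (hp : Prime p) :
    Function.Surjective (hp.valuation K) := by
  intro y
  by_cases hy : y = 0
  · exact ⟨0, by simp [hy]⟩
  · refine ⟨algebraMap R K p ^ (-WithZero.log y), ?_⟩
    rw [map_zpow₀, hp.valuation_algebraMap K hp.ne_zero,
      multiplicity_self, ← WithZero.exp_zsmul]
    simp [WithZero.exp_log hy]

-- Associated primes give one valuation, so the factors of an element account for all valuations
-- nontrivial on it.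
variable {K} in
theorem Prime.valuation_eq_of_associated {p q : R} (hp : Prime p) (hq : Prime q)
    (h : Associated p q) : hp.valuation K = hq.valuation K := by
  ext x
  obtain ⟨a, b, hb, rfl⟩ := IsFractionRing.div_surjective (A := R) x
  by_cases ha : a = 0
  · simp [ha]
  rw [map_div₀, map_div₀, hp.valuation_algebraMap K ha, hq.valuation_algebraMap K ha,
    hp.valuation_algebraMap K (nonZeroDivisors.ne_zero hb),
    hq.valuation_algebraMap K (nonZeroDivisors.ne_zero hb),
    multiplicity_eq_of_associated_left h, multiplicity_eq_of_associated_left h]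

end PrimeValuation

/-! ### Unique factorization, gcds and principal divisors. -/

section Factorial

variable {R K : Type*} [CommRing R] [IsDomain R] [Field K] [Algebra R K] [IsFractionRing R K]

open FractionalIdeal

/-- A unique factorization domain is a Krull domain. -/
theorem UniqueFactorizationMonoid.isKrullDomain [UniqueFactorizationMonoid R] :
    IsKrullDomain R K := by
  refine ⟨Set.range fun p : {p : R // Prime p} => p.2.valuation K, ?_, ?_, ?_⟩
  · rintro _ ⟨p, rfl⟩
    exact p.2.valuation_surjective K
  · intro x
    constructor
    · rintro ⟨r, rfl⟩ _ ⟨p, rfl⟩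
      exact p.2.valuation_algebraMap_le_one K r
    · intro h
      refine IsFractionRing.isInteger_of_isUnit_den (A := R) ?_
      by_contra hu
      have hden : (IsFractionRing.den R x : R) ≠ 0 := nonZeroDivisors.ne_zero (Subtype.prop _)
      -- A prime in the reduced denominator does not divide the numerator, so `x` has value above 1
      -- there.
      obtain ⟨p, hp, hpd⟩ := WfDvdMonoid.exists_irreducible_factor hu hden
      have hp' : Prime p := irreducible_iff_prime.1 hp
      have hpn : ¬ p ∣ IsFractionRing.num R x := fun hpn =>
        hp.not_isUnit (IsFractionRing.num_den_reduced R x hpn hpd)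
      have hnum : IsFractionRing.num R x ≠ 0 := fun h0 => hpn (h0 ▸ dvd_zero p)
      have hv := h _ ⟨⟨p, hp'⟩, rfl⟩
      rw [← IsFractionRing.mk'_num_den' R x, map_div₀,
        (hp'.valuation_algebraMap_eq_one_iff K hnum).2 hpn, one_div] at hv
      have hlt : hp'.valuation K (algebraMap R K (IsFractionRing.den R x)) < 1 :=
        (hp'.valuation_algebraMap_le_one K _).lt_of_ne fun h1 =>
          (hp'.valuation_algebraMap_eq_one_iff K hden).1 h1 hpd
      have hpos : 0 < hp'.valuation K (algebraMap R K (IsFractionRing.den R x)) :=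
        zero_lt_iff.2 ((Valuation.ne_zero_iff _).2 (by simp))
      exact absurd hv (not_le.2 ((one_lt_inv₀ hpos).2 hlt))
  · intro x hx
    obtain ⟨a, b, hb, rfl⟩ := IsFractionRing.div_surjective (A := R) x
    have hb0 : b ≠ 0 := nonZeroDivisors.ne_zero hb
    have ha0 : a ≠ 0 := by
      rintro rfl
      simp at hx
    classical
    have hfin : (Subtype.val ⁻¹' ((factors (a * b)).toFinset : Set R) :
        Set {p : R // Prime p}).Finite :=
      (Finset.finite_toSet _).preimage Subtype.val_injective.injOn
    refine (hfin.image fun p => p.2.valuation K).subset ?_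
    rintro _ ⟨⟨p, rfl⟩, hv⟩
    have hdvd : p.1 ∣ a * b := by
      by_contra hn
      apply hv
      change p.2.valuation K _ = 1
      rw [map_div₀, (p.2.valuation_algebraMap_eq_one_iff K ha0).2 fun h => hn (h.mul_right b),
        (p.2.valuation_algebraMap_eq_one_iff K hb0).2 fun h => hn (h.mul_left a), _root_.div_one]
    obtain ⟨q, hq, hpq⟩ := exists_mem_factors_of_dvd (mul_ne_zero ha0 hb0) p.2.irreducible hdvd
    have hqp := prime_of_factor q hq
    exact ⟨⟨q, hqp⟩, by simpa using hq, (p.2.valuation_eq_of_associated hqp hpq).symm⟩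

/-- In a unique factorization domain the elements of a nonzero ideal have a nonzero greatest common
divisor. -/
theorem UniqueFactorizationMonoid.exists_gcd_ideal [UniqueFactorizationMonoid R] {I : Ideal R}
    (hI : I ≠ ⊥) : ∃ d : R, d ≠ 0 ∧ ∀ s : R, (∀ a ∈ I, s ∣ a) ↔ s ∣ d := by
  obtain ⟨a, ha, ha0⟩ := Submodule.exists_mem_ne_zero_of_ne_bot hI
  -- A cofactor `e` minimal for divisibility makes the common divisor `d` as large as possible.
  obtain ⟨e, ⟨d, hde, hd⟩, hmin⟩ := (wellFounded_dvdNotUnit (α := R)).has_min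
    {e : R | ∃ d, d * e = a ∧ ∀ b ∈ I, d ∣ b} ⟨a, 1, one_mul a, fun b _ => one_dvd b⟩
  have hd0 : d ≠ 0 := by
    rintro rfl
    exact ha0 (by rw [← hde, zero_mul])
  refine ⟨d, hd0, fun s => ⟨fun hs => ?_, fun hs b hb => hs.trans (hd b hb)⟩⟩
  let := UniqueFactorizationMonoid.toGCDMonoid R
  obtain ⟨k, hk⟩ := dvd_lcm_left d s
  -- The lcm `d * k` is again a common divisor; minimality of `e` forces `k` to be a unit, so `s ∣
  -- d`.
  have hlcm : ∀ b ∈ I, lcm d s ∣ b := fun b hb => lcm_dvd (hd b hb) (hs b hb)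
  obtain ⟨e', he'⟩ := hlcm a ha
  have hee : e = e' * k := by
    apply mul_left_cancel₀ hd0
    rw [hde, he', hk]
    ring
  have hk1 : IsUnit k := by
    by_contra hku
    refine hmin e' ⟨lcm d s, he'.symm, hlcm⟩ ⟨?_, k, hku, hee⟩
    rintro rfl
    exact ha0 (by rw [he', mul_zero])
  have hs' := dvd_lcm_right d s
  rwa [hk, hk1.dvd_mul_right] at hs'

/-- Every integral divisor of a unique factorization domain is principal. -/
theorem UniqueFactorizationMonoid.isPrincipal_of_isIntegral [UniqueFactorizationMonoid R]
    (D : Divisor R K) (hD : D.IsIntegral) : D.IsPrincipal := by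
  induction D using Quotient.inductionOn with | _ a
  have h1 : a.1 ≤ 1 := by
    have := hD 1 one_ne_zero (by rw [spanSingleton_one])
    rwa [spanSingleton_one] at this
  obtain ⟨I, hIa⟩ := le_one_iff_exists_coeIdeal.1 h1
  have hI : I ≠ ⊥ := by
    rintro rfl
    exact a.2 (by rw [← hIa, coeIdeal_bot])
  obtain ⟨d, hd0, hd⟩ := exists_gcd_ideal hI
  have hdK : algebraMap R K d ≠ 0 := by simpa using hd0
  refine ⟨algebraMap R K d, hdK, Quotient.sound ⟨fun x hx hax => ?_, fun x _ hx => ?_⟩⟩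
  · rw [spanSingleton_le_iff_mem]
    have hxnd := IsFractionRing.mk'_num_den' R x
    have hden : algebraMap R K (IsFractionRing.den R x) ≠ 0 := by
      simp
    have hdvd : IsFractionRing.num R x ∣ d := by
      refine (hd _).1 fun b hb => ?_
      have hbx := hax (show algebraMap R K b ∈ a.1 by
        rw [← hIa]; exact mem_coeIdeal_of_mem R⁰ hb)
      obtain ⟨r, hr⟩ := (mem_spanSingleton R⁰).1 hbx
      have heq : b * IsFractionRing.den R x = IsFractionRing.num R x * r := by
        apply IsFractionRing.injective R K
        rw [map_mul, map_mul, ← hr, Algebra.smul_def]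
        nth_rw 1 [← hxnd]
        field_simp
      exact (IsFractionRing.num_den_reduced R x).dvd_of_dvd_mul_right ⟨r, heq⟩
    obtain ⟨c, hc⟩ := hdvd
    refine (mem_spanSingleton R⁰).2 ⟨c * IsFractionRing.den R x, ?_⟩
    rw [Algebra.smul_def, hc, map_mul, map_mul]
    nth_rw 2 [← hxnd]
    field_simp
  · refine le_trans ?_ hx
    rw [← hIa]
    intro y hy
    obtain ⟨b, hb, rfl⟩ := (mem_coeIdeal R⁰).1 hy
    obtain ⟨c, hc⟩ := (hd d).2 dvd_rfl b hb
    exact (mem_spanSingleton R⁰).2 ⟨c, by rw [Algebra.smul_def, hc, map_mul, mul_comm]⟩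

/-- A Krull domain satisfies the ascending chain condition on principal ideals. -/
theorem IsKrullDomain.wfDvdMonoid (h : IsKrullDomain R K) : WfDvdMonoid R := by
  classical
  obtain ⟨S, -, hS, hfin⟩ := h
  let g (v : Valuation K (WithZero (Multiplicative ℤ))) (r : R) : ℕ :=
    (-WithZero.log (v (algebraMap R K r))).toNat
  -- Every nonzero element properly divides 0, hence the value `⊤`.
  let f (r : R) : WithTop ℕ := if r = 0 then ⊤ else ((∑ᶠ v ∈ S, g v r : ℕ) : WithTop ℕ)
  have hle : ∀ v ∈ S, ∀ r : R, v (algebraMap R K r) ≤ 1 := fun v hv r => (hS _).1 ⟨r, rfl⟩ v hv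
  have hne : ∀ (v : Valuation K (WithZero (Multiplicative ℤ))) {r : R}, r ≠ 0 →
      v (algebraMap R K r) ≠ 0 := fun v r hr => (Valuation.ne_zero_iff _).2 (by simpa using hr)
  have hlog : ∀ v ∈ S, ∀ {r : R}, r ≠ 0 → WithZero.log (v (algebraMap R K r)) ≤ 0 :=
    fun v hv r hr => (WithZero.log_le_iff_le_exp (hne v hr)).2 (hle v hv r)
  -- Needed because `finsum` is 0 by default on infinite support.
  have hsupp : ∀ {r : R}, r ≠ 0 → (S ∩ Function.support fun v => g v r).Finite := by
    intro r hr
    refine (hfin (algebraMap R K r) (by simpa using hr)).subset ?_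
    rintro v ⟨hv, hg⟩
    refine ⟨hv, fun h1 => hg ?_⟩
    simp [g, h1]
  have key : ∀ a b : R, DvdNotUnit a b → f a < f b := by
    rintro a b ⟨ha, c, hc, rfl⟩
    by_cases hc0 : c = 0
    · simp [f, hc0, ha]
    simp only [f, if_neg ha, if_neg (mul_ne_zero ha hc0)]
    have hadd : ∑ᶠ v ∈ S, g v (a * c) = ∑ᶠ v ∈ S, g v a + ∑ᶠ v ∈ S, g v c := by
      rw [← finsum_mem_add_distrib' (hsupp ha) (hsupp hc0)]
      refine finsum_mem_congr rfl fun v hv => ?_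
      have h1 := hlog v hv ha
      have h2 := hlog v hv hc0
      simp only [g]
      rw [map_mul, map_mul, WithZero.log_mul (hne v ha) (hne v hc0)]
      omega
    -- Otherwise `c⁻¹` also has all values at most 1, and `c` is a unit.
    obtain ⟨v, hv, hvc⟩ : ∃ v ∈ S, v (algebraMap R K c) < 1 := by
      by_contra! H
      obtain ⟨r, hr⟩ := (hS (algebraMap R K c)⁻¹).2 fun v hv => by
        rw [map_inv₀]
        exact inv_le_one_of_one_le₀ (H v hv)
      refine hc (IsUnit.of_mul_eq_one r (IsFractionRing.injective R K ?_))
      rw [map_mul, hr, map_one, mul_inv_cancel₀ (by simpa using hc0)]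
    have hpos : 0 < ∑ᶠ v ∈ S, g v c := by
      have hg : g v c ≠ 0 := by
        have : WithZero.log (v (algebraMap R K c)) < 0 :=
          (WithZero.log_lt_iff_lt_exp (hne v hc0)).2 hvc
        simp only [g]
        omega
      refine Nat.pos_of_ne_zero fun h0 => hg ?_
      rw [finsum_mem_eq_sum _ (hsupp hc0), Finset.sum_eq_zero_iff] at h0
      exact h0 v ((Set.Finite.mem_toFinset _).2 ⟨hv, hg⟩)
    rw [hadd]
    exact WithTop.coe_lt_coe.2 (Nat.lt_add_of_pos_right hpos)
  exact ⟨Subrelation.wf (fun {a b} h => key a b h) (InvImage.wf f wellFounded_lt)⟩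

/-- If every integral divisor is principal, any two elements have a greatest common divisor. -/
theorem exists_gcd_of_forall_isPrincipal
    (h : ∀ D : Divisor R K, D.IsIntegral → D.IsPrincipal) (a b : R) :
    ∃ c : R, ∀ d : R, d ∣ a ∧ d ∣ b ↔ d ∣ c := by
  by_cases hab : Ideal.span {a, b} = ⊥
  · rw [Ideal.span_eq_bot] at hab
    exact ⟨0, fun d => by simp [hab a (by simp), hab b (by simp)]⟩
  have hle : ∀ d : R, (Ideal.span {a, b} : FractionalIdeal R⁰ K) ≤
      spanSingleton R⁰ (algebraMap R K d) ↔ d ∣ a ∧ d ∣ b := by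
    intro d
    rw [← coeIdeal_span_singleton, coeIdeal_le_coeIdeal, Ideal.span_le]
    simp [Set.insert_subset_iff, Ideal.mem_span_singleton]
  obtain ⟨x, hx, hxD⟩ := h (Divisor.div ⟨(Ideal.span {a, b} : Ideal R), coeIdeal_ne_zero.2 hab⟩)
    fun y _ hy => coeIdeal_le_one.trans hy
  obtain ⟨h1, h2⟩ := Quotient.exact hxD
  -- Comparison with `R` itself shows that the generator `x` lies in `R`.
  have hx1 := h1 1 one_ne_zero (by rw [spanSingleton_one]; exact coeIdeal_le_one)
  rw [spanSingleton_one] at hx1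
  obtain ⟨c, rfl⟩ := (mem_one_iff R⁰).1 (hx1 (mem_spanSingleton_self R⁰ x))
  refine ⟨c, fun d => ⟨fun hd => ?_, fun hd => ?_⟩⟩
  · have hd0 : d ≠ 0 := by
      rintro rfl
      simp only [zero_dvd_iff] at hd
      exact hab (by simp [hd.1, hd.2])
    have : spanSingleton R⁰ (algebraMap R K c) ≤ spanSingleton R⁰ (algebraMap R K d) :=
      h1 _ (by simpa using hd0) ((hle d).2 hd)
    rwa [← coeIdeal_span_singleton, ← coeIdeal_span_singleton, coeIdeal_le_coeIdeal,
      Ideal.span_singleton_le_span_singleton] at this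
  · have := (hle c).1 (h2 _ hx le_rfl)
    exact ⟨hd.trans this.1, hd.trans this.2⟩

/-- A Krull domain all of whose integral divisors are principal is factorial. -/
theorem IsKrullDomain.uniqueFactorizationMonoid (hR : IsKrullDomain R K)
    (h : ∀ D : Divisor R K, D.IsIntegral → D.IsPrincipal) : UniqueFactorizationMonoid R := by
  classical
  let := gcdMonoidOfExistsGCD (exists_gcd_of_forall_isPrincipal h)
  have := hR.wfDvdMonoid
  exact { irreducible_iff_prime := fun {_} => irreducible_iff_prime }

end Factorial

theorem theorem3p2 (R K : Type*) [CommRing R] [IsDomain R] [Field K] [Algebra R K]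
    [IsFractionRing R K] :
    (IsDedekindDomain R ↔
      IsKrullDomain R K ∧
        ∀ I : Ideal R, I ≠ ⊥ → IsDivisorial R K (I : FractionalIdeal R⁰ K)) ∧
    (UniqueFactorizationMonoid R ↔
      IsKrullDomain R K ∧ ∀ D : Divisor R K, D.IsIntegral → D.IsPrincipal) := by
  refine ⟨⟨fun h => ⟨IsDedekindDomain.isKrullDomain R K, fun I hI => ?_⟩,
    fun h => h.1.isDedekindDomain h.2⟩,
    ⟨fun h => ⟨UniqueFactorizationMonoid.isKrullDomain,
      UniqueFactorizationMonoid.isPrincipal_of_isIntegral⟩,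
      fun h => h.1.uniqueFactorizationMonoid h.2⟩⟩
  have hI' : (I : FractionalIdeal R⁰ K) ≠ 0 := FractionalIdeal.coeIdeal_ne_zero.2 hI
  exact .of_mul_inv_cancel hI' (isDedekindDomain_iff_mul_inv_cancel.1 h _ hI')
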